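/- Let $P$ be a probability distribution on a measurable space $\mathcal X$, and let $y:\mathcal X\to\{-1,1\}$ be a measurable labelling. Write $\mathrm{sgn}(t)=1$ for $t\ge 0$ and $\mathrm{sgn}(t)=-1$ for $t<0$, let $\mathcal L(y',y)=\mathbf 1\{\mathrm{sgn}(y')\ne y\}$ be the zero-one loss, and let $R_P(f)=\mathbb E_{\mathbf x\sim P}[\mathcal L(f(\mathbf x),y(\mathbf x))]$ be the risk of $f:\mathcal X\to\mathbb R$. Let $\mathcal F$ be a class of measurable functions $f:\mathcal X\to\mathbb R$ of finite VC dimension $h$, that is, $h$ is the largest cardinality of a finite subset of $\mathcal X$ all of whose dichotomies are induced by functions $\mathrm{sgn}(f)$, $f\in\mathcal F$. Assume that $\mathcal F$ is measurable in the following sense: for all $m$ and all $b\in\{-1,1\}^m$, the set of $(z_1,\dots,z_m)\in\mathcal X^m$ for which some $f\in\mathcal F$ satisfies $\mathrm{sgn}(f(z_i))=b_i$ for all $i$ is $P^m$-measurable (measurable up to a $P^m$-null set). Let $n\ge 1$ with $h\le 2n$, let $0<\eta\le 1$, let $\mathbf x_1,\dots,\mathbf x_n$ be sampled i.i.d. from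 $P$, and put $y_i=y(\mathbf x_i)$. Then with probability at least $1-\eta$ the following holds simultaneously for all $f\in\mathcal F$ and all soft labels $\ell^*=(\ell^*_1,\dots,\ell^*_n)\in\mathbb R^n$ (so that both may be chosen depending on the sample, for instance $\ell^*$ as the labels induced by a data adjacency graph): $$R_P(f)\ \le\ \frac1n\sum_{i=1}^n\mathcal L\bigl(f(\mathbf x_i),\mathrm{sgn}(\ell_i^*)\bigr)+\frac1n\sum_{i=1}^n(\ell_i^*-y_i)^2+\sqrt{\frac{h\,(\ln(2n/h)+1)-\ln(\eta/4)}{n}},$$ where $h\,(\ln(2n/h)+1)$ is read as $0$ for $h=0$. -/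

import Mathlib

open MeasureTheory ProbabilityTheory

noncomputable section

namespace MaxMarginCuts

/-- The two-valued sign of a real number, used as a predicted label in `{-1, 1}`.
A prediction has to be one of the two labels, so `0` is given the label `1`. -/
def sgn (t : ℝ) : ℝ := if 0 ≤ t then 1 else -1

/-- The zero-one loss of the prediction `sgn y'` given the ground truth `y`. -/
def zeroOneLoss (y' y : ℝ) : ℝ := if sgn y' ≠ y then 1 else 0

/-- The risk of `f`: the expected zero-one loss under the distribution `P` of the examples, with
the labels given by the deterministic function `y`. -/
def risk {𝒳 : Type*} [MeasurableSpace 𝒳] (P : Measure 𝒳) (y f : 𝒳 → ℝ) : ℝ :=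
  ∫ x, zeroOneLoss (f x) (y x) ∂P

/-- A class `F` of real-valued discriminators shatters a finite set `S` of points if every
dichotomy of `S` is induced by the sign of a member of `F`. -/
def Shatters {𝒳 : Type*} (F : Set (𝒳 → ℝ)) (S : Finset 𝒳) : Prop :=
  ∀ T ⊆ S, ∃ f ∈ F, ∀ x ∈ S, sgn (f x) = 1 ↔ x ∈ T

/-- The VC dimension of a class of discriminators: the supremum of the cardinalities of the finite
sets that it shatters (`⊤` if these are unbounded). -/
def vcDim {𝒳 : Type*} (F : Set (𝒳 → ℝ)) : ℕ∞ :=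
  ⨆ (S : Finset 𝒳) (_ : Shatters F S), (S.card : ℕ∞)

/-- Measurability of a (possibly uncountable) class of discriminators with respect to `P`: its
members are measurable, and for every sequence `b` of `m` labels, the set of the `m`-tuples of
points that some member of the class labels by `b` is measurable up to a null set of `P ^ m`. -/
structure IsMeasurableClass {𝒳 : Type*} [MeasurableSpace 𝒳] (P : Measure 𝒳)
    (F : Set (𝒳 → ℝ)) : Prop where
  measurable : ∀ f ∈ F, Measurable f
  nullMeasurableSet : ∀ (m : ℕ) (b : Fin m → ℝ),
    NullMeasurableSet {z : Fin m → 𝒳 | ∃ f ∈ F, ∀ i, sgn (f (z i)) = b i}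
      (Measure.pi fun _ => P)

/-- The inductive error `Δ_I(h, n, η)`. For `h = 0` the term `h (ln (2 n / h) + 1)` is `0`. -/
def inductiveError (h n : ℕ) (η : ℝ) : ℝ :=
  Real.sqrt (((h : ℝ) * (Real.log (2 * (n : ℝ) / (h : ℝ)) + 1) - Real.log (η / 4)) / (n : ℝ))

end MaxMarginCuts

end

/-!
Since `sgn l ≠ b` forces `(l - b) ^ 2 ≥ 1` for a label `b`, the zero-one loss against `b` exceeds
that against `sgn l` by at most `(l - b) ^ 2`. This holds pointwise, so soft labels need no
probability: what remains is a uniform bound on the gap between the risk and the empirical risk.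

For that, pool the sample with a ghost sample of the same size and permute the `2 n` points
uniformly. Conditionally on the pool, the errors of a member of the class on the sample form a draw
of `n` out of `2 n` without replacement, and by Sauer and Shelah only
`exp (h * (log (2 * n / h) + 1))` error patterns occur. Jensen's inequality for the mean over the
ghost sample and Markov's inequality for the sum of the exponential moments of all patterns give
the deviation bound. Serfling's bound for draws without replacement yields the exponent
`-(n - 1) * ε ^ 2`, where random signs would only give `-n * ε ^ 2 / 2`; the missing factor
`exp (ε ^ 2)` matters only for `ε < 1` and is then absorbed by the `4` in `η / 4`.
-/

namespace MaxMarginCuts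

open scoped BigOperators

section Sampling

lemma expect_exp_mul_le {ι : Type*} [Fintype ι] [Nonempty ι] {v : ι → ℝ}
    (hv : ∀ i, v i ∈ Set.Icc (0 : ℝ) 1) (s : ℝ) :
    𝔼 i, Real.exp (s * v i) ≤ Real.exp (s * 𝔼 i, v i + s ^ 2 / 8) := by
  let _ : MeasurableSpace ι := ⊤
  set U := (PMF.uniformOfFintype ι).toMeasure
  have integral_eq_expect (g : ι → ℝ) : ∫ i, g i ∂U = 𝔼 i, g i := by
    simp [U, PMF.integral_eq_sum, Fintype.expect_eq_sum_div_card, ← Finset.mul_sum,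
      div_eq_inv_mul]
  have mgf_centered_le := (hasSubgaussianMGF_of_mem_Icc (μ := U) (X := v)
    (measurable_of_finite v).aemeasurable (ae_of_all _ hv)).mgf_le s
  rw [mgf, integral_eq_expect, integral_eq_expect] at mgf_centered_le
  calc 𝔼 i, Real.exp (s * v i)
      = Real.exp (s * 𝔼 i, v i) * 𝔼 i, Real.exp (s * (v i - 𝔼 j, v j)) := by
        rw [Finset.mul_expect]
        exact Finset.expect_congr rfl fun i _ => by rw [← Real.exp_add]; ring_nf
    _ ≤ Real.exp (s * 𝔼 i, v i) * Real.exp (s ^ 2 / 8) := by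
        gcongr
        refine mgf_centered_le.trans_eq ?_
        congr 1
        push_cast
        norm_num
        ring
    _ = _ := (Real.exp_add _ _).symm

lemma expect_perm_fin_succ {k : ℕ} (g : Equiv.Perm (Fin (k + 1)) → ℝ) :
    𝔼 π, g π = 𝔼 p, 𝔼 σ, g (Equiv.Perm.decomposeFin.symm (p, σ)) := by
  rw [← Finset.expect_product', Finset.univ_product_univ]
  exact Fintype.expect_equiv Equiv.Perm.decomposeFin _ _ fun π => by simp

lemma expect_swap_zero_succ {k : ℕ} (v : Fin (k + 1) → ℝ) (p : Fin (k + 1)) :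
    𝔼 i : Fin k, v (Equiv.swap 0 p i.succ) = ((k + 1) * 𝔼 i, v i - v p) / k := by
  have sum_eq : ∑ i, v i = v p + ∑ i : Fin k, v (Equiv.swap 0 p i.succ) := by
    rw [← Equiv.sum_comp (Equiv.swap 0 p) v, Fin.sum_univ_succ, Equiv.swap_apply_left]
  simp only [Fintype.expect_eq_sum_div_card, Fintype.card_fin, sum_eq]
  push_cast
  field_simp
  ring

/-- Given the first draw `p`, the other `m` draws have mean `m / k` times the total without `v p`,
so the influence of `v p` on the sum is damped by the factor `(k - m) / k`. -/
lemma expect_perm_exp_mul_sum_succ_le {k m : ℕ} (hk : 0 < k) (hm : m ≤ k) {v : Fin (k + 1) → ℝ}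
    (hv : ∀ i, v i ∈ Set.Icc (0 : ℝ) 1) (s : ℝ) {b : ℝ}
    (hb : ∀ w : Fin k → ℝ, (∀ i, w i ∈ Set.Icc (0 : ℝ) 1) →
      𝔼 σ : Equiv.Perm (Fin k), Real.exp (s * ∑ i : Fin m, w (σ (i.castLE hm))) ≤
        Real.exp (s * (m * 𝔼 i, w i) + s ^ 2 / 8 * b)) :
    𝔼 π : Equiv.Perm (Fin (k + 1)),
        Real.exp (s * ∑ i : Fin (m + 1), v (π (i.castLE (Nat.succ_le_succ hm)))) ≤
      Real.exp (s * ((m + 1) * 𝔼 i, v i) + s ^ 2 / 8 * (b + ((k - m) / k) ^ 2)) := by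
  set a := 𝔼 i, v i with ha
  set r : ℝ := (k - m) / k with hr
  set c := s * (m * ((k + 1) * a / k)) + s ^ 2 / 8 * b with hc
  have conditional_le (p : Fin (k + 1)) :
      𝔼 σ, Real.exp (s * ∑ i : Fin (m + 1), v (Equiv.Perm.decomposeFin.symm (p, σ)
        (i.castLE (Nat.succ_le_succ hm)))) ≤ Real.exp c * Real.exp (s * r * v p) := by
    have rest_le := hb (fun i => v (Equiv.swap 0 p i.succ)) fun i => hv _
    rw [expect_swap_zero_succ, ← ha] at rest_le
    calc _ = Real.exp (s * v p) * 𝔼 σ : Equiv.Perm (Fin k),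
            Real.exp (s * ∑ i : Fin m, v (Equiv.swap 0 p (σ (i.castLE hm)).succ)) := by
          rw [Finset.mul_expect]
          refine Finset.expect_congr rfl fun σ _ => ?_
          rw [← Real.exp_add, ← mul_add, Fin.sum_univ_succ]
          simp [Fin.castLE_succ]
      _ ≤ _ := mul_le_mul_of_nonneg_left rest_le (Real.exp_pos _).le
      _ = _ := by
          rw [← Real.exp_add, ← Real.exp_add, hc, hr]
          congr 1
          field_simp
          ring
  rw [expect_perm_fin_succ]
  calc _ ≤ 𝔼 p, Real.exp c * Real.exp (s * r * v p) :=
        Finset.expect_le_expect fun p _ => conditional_le p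
    _ ≤ Real.exp c * Real.exp (s * r * a + (s * r) ^ 2 / 8) := by
        rw [← Finset.mul_expect]
        gcongr
        exact expect_exp_mul_le hv _
    _ = _ := by
        rw [← Real.exp_add, hc, hr]
        congr 1
        field_simp
        ring

/-- Serfling's inequality. Hoeffding's bound would have `1` for the finite-population correction
`(d + 1) / (d + m)`. -/
lemma expect_perm_exp_mul_sum_le {d : ℕ} (hd : 0 < d) (m : ℕ) {v : Fin (d + m) → ℝ}
    (hv : ∀ i, v i ∈ Set.Icc (0 : ℝ) 1) (s : ℝ) :
    𝔼 π : Equiv.Perm (Fin (d + m)),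
        Real.exp (s * ∑ i : Fin m, v (π (i.castLE (Nat.le_add_left m d)))) ≤
      Real.exp (s * (m * 𝔼 i, v i) + s ^ 2 / 8 * (m * (d + 1) / (d + m))) := by
  induction m with
  | zero => simp
  | succ m ih =>
    refine (expect_perm_exp_mul_sum_succ_le (Nat.add_pos_left hd m) (Nat.le_add_left m d) hv s
      fun _ hw => ih hw).trans ?_
    have variance_le : (m * (d + 1) / (d + m) + ((↑(d + m) - m) / ↑(d + m)) ^ 2 : ℝ) ≤
        (m + 1) * (d + 1) / (d + (m + 1)) := by
      push_cast
      rw [add_sub_cancel_right, div_pow, div_add_div _ _ (by positivity) (by positivity),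
        div_le_div_iff₀ (by positivity) (by positivity)]
      have : (0 : ℝ) ≤ d * m * (d + m) := by positivity
      nlinarith
    push_cast at variance_le ⊢
    exact Real.exp_le_exp.2 <| add_le_add le_rfl <|
      mul_le_mul_of_nonneg_left variance_le (by positivity)

/-- The sum of a function over the second half of a population of `n + n` members, minus its sum
over the first half. The first half plays the role of the sample, the second half that of the ghost
sample. -/
def halvesGap {n : ℕ} (v : Fin (n + n) → ℝ) : ℝ :=
  ∑ i, v (Fin.natAdd n i) - ∑ i, v (Fin.castAdd n i)

lemma halvesGap_eq_sum_sub {n : ℕ} (v : Fin (n + n) → ℝ) :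
    halvesGap v = ∑ i, v i - 2 * ∑ i, v (Fin.castAdd n i) := by
  rw [halvesGap, Fin.sum_univ_add]
  ring

lemma expect_perm_exp_mul_halvesGap_le {n : ℕ} (hn : 0 < n) {v : Fin (n + n) → ℝ}
    (hv : ∀ i, v i ∈ Set.Icc (0 : ℝ) 1) (t : ℝ) :
    𝔼 π : Equiv.Perm (Fin (n + n)), Real.exp (t * halvesGap (v ∘ π)) ≤
      Real.exp (t ^ 2 * (n + 1) / 4) := by
  calc _ = Real.exp (t * ∑ i, v i) * 𝔼 π : Equiv.Perm (Fin (n + n)),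
          Real.exp (-2 * t * ∑ i : Fin n, v (π (i.castLE (Nat.le_add_left n n)))) := by
        rw [Finset.mul_expect]
        refine Finset.expect_congr rfl fun π _ => ?_
        rw [← Real.exp_add, halvesGap_eq_sum_sub, ← Equiv.sum_comp π v]
        simp only [Function.comp_apply, Fin.castAdd]
        ring_nf
    _ ≤ _ := mul_le_mul_of_nonneg_left (expect_perm_exp_mul_sum_le hn n hv _) (Real.exp_pos _).le
    _ = _ := by
        rw [← Real.exp_add, Fintype.expect_eq_sum_div_card, Fintype.card_fin]
        congr 1
        push_cast
        field_simp
        ring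

end Sampling

section Growth

lemma sum_choose_le_exp {h N : ℕ} (hN : h ≤ N) :
    (∑ k ∈ Finset.Iic h, N.choose k : ℝ) ≤ Real.exp (h * (Real.log (N / h) + 1)) := by
  rcases Nat.eq_zero_or_pos h with rfl | h_pos
  · simp [show Finset.Iic 0 = ({0} : Finset ℕ) from rfl]
  have N_pos : 0 < N := h_pos.trans_le hN
  have one_le_ratio : 1 ≤ (N / h : ℝ) := (one_le_div (by positivity)).2 (by exact_mod_cast hN)
  calc (∑ k ∈ Finset.Iic h, N.choose k : ℝ)
      ≤ ∑ k ∈ Finset.Iic h, (N / h : ℝ) ^ h * ((h / N : ℝ) ^ k * N.choose k) := by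
        refine Finset.sum_le_sum fun k hk => ?_
        rw [← mul_assoc]
        refine le_mul_of_one_le_left (by positivity) ?_
        calc (1 : ℝ) = (N / h : ℝ) ^ k * (h / N : ℝ) ^ k := by
              rw [← mul_pow, div_mul_div_cancel₀ (by positivity), div_self (by positivity), one_pow]
          _ ≤ (N / h : ℝ) ^ h * (h / N : ℝ) ^ k := by
              gcongr
              exact Finset.mem_Iic.1 hk
    _ ≤ ∑ k ∈ Finset.range (N + 1), (N / h : ℝ) ^ h * ((h / N : ℝ) ^ k * N.choose k) := by
        refine Finset.sum_le_sum_of_subset_of_nonneg (fun k hk => ?_) fun _ _ _ => by positivity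
        exact Finset.mem_range_succ_iff.2 ((Finset.mem_Iic.1 hk).trans hN)
    _ = (N / h : ℝ) ^ h * (h / N + 1 : ℝ) ^ N := by
        rw [← Finset.mul_sum, add_pow]
        simp only [one_pow, mul_one]
    _ ≤ (N / h : ℝ) ^ h * Real.exp (h / N) ^ N := by
        gcongr
        exact Real.add_one_le_exp _
    _ = _ := by
        rw [mul_add, Real.exp_add, mul_one, ← Real.exp_nat_mul,
          mul_div_cancel₀ _ (by positivity), Real.exp_nat_mul, Real.exp_log (by positivity)]

lemma card_le_sum_choose_of_vcDim_le {ι : Type*} [Fintype ι] [DecidableEq ι]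
    {𝒯 : Finset (Finset ι)} {h : ℕ} (h𝒯 : 𝒯.vcDim ≤ h) :
    𝒯.card ≤ ∑ k ∈ Finset.Iic h, (Fintype.card ι).choose k :=
  (Finset.card_le_card_shatterer 𝒯).trans <| Finset.card_shatterer_le_sum_vcDim.trans <|
    Finset.sum_le_sum_of_subset (Finset.Iic_subset_Iic.2 h𝒯)

variable {𝒳 ι κ : Type*} [Fintype ι] [Fintype κ]

open Classical in
/-- The trace of a class `𝒜` of sets on a tuple `z` of points: the sets of indices `i` with
`z i ∈ A`, for `A` in `𝒜`. Traces are recorded on indices rather than on points because the tuple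
may have repeated entries. -/
noncomputable def trace (𝒜 : Set (Set 𝒳)) (z : ι → 𝒳) : Finset (Finset ι) :=
  Finset.univ.filter fun T => ∃ A ∈ 𝒜, ∀ i, i ∈ T ↔ z i ∈ A

lemma mem_trace {𝒜 : Set (Set 𝒳)} {z : ι → 𝒳} {T : Finset ι} :
    T ∈ trace 𝒜 z ↔ ∃ A ∈ 𝒜, ∀ i, i ∈ T ↔ z i ∈ A := by
  simp only [trace, Finset.mem_filter, Finset.mem_univ, true_and]

lemma trace_comp_equiv (𝒜 : Set (Set 𝒳)) (z : ι → 𝒳) (e : κ ≃ ι) :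
    trace 𝒜 (z ∘ e) = (trace 𝒜 z).map e.symm.finsetCongr.toEmbedding := by
  ext T
  simp only [Finset.mem_map_equiv, mem_trace, Equiv.finsetCongr_symm, Equiv.symm_symm,
    Equiv.finsetCongr_apply, Function.comp_apply]
  refine exists_congr fun A => and_congr_right fun _ => ?_
  rw [← e.forall_congr_right]
  simp only [Equiv.symm_apply_apply]

/-- The sets of points to which the discriminators in `F` assign a label other than that given by
`y`. -/
def errorSets (F : Set (𝒳 → ℝ)) (y : 𝒳 → ℝ) : Set (Set 𝒳) :=
  (fun f => {x | sgn (f x) ≠ y x}) '' F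

/-- The sets of points to which the discriminators in `F` assign the label `1`. -/
def positiveSets (F : Set (𝒳 → ℝ)) : Set (Set 𝒳) :=
  (fun f => {x | sgn (f x) = 1}) '' F

lemma vcDim_trace_positiveSets_le [DecidableEq ι] {F : Set (𝒳 → ℝ)} {h : ℕ} (hF : vcDim F ≤ h)
    (z : ι → 𝒳) : (trace (positiveSets F) z).vcDim ≤ h := by
  classical
  refine Finset.sup_le fun S hS => ?_
  have exists_of_subset {T} (hT : T ⊆ S) : ∃ f ∈ F, ∀ i ∈ S, sgn (f (z i)) = 1 ↔ i ∈ T := by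
    obtain ⟨U, hU, rfl⟩ := Finset.mem_shatterer.1 hS hT
    obtain ⟨_, ⟨f, hf, rfl⟩, hfU⟩ := mem_trace.1 hU
    refine ⟨f, hf, fun i hi => ?_⟩
    rw [Finset.mem_inter, and_iff_right hi, hfU, Set.mem_ofPred_eq]
  have injOn : Set.InjOn z S := by
    intro i hi j hj hij
    obtain ⟨f, -, hf⟩ := exists_of_subset (Finset.singleton_subset_iff.2 hi)
    have label_i := (hf i hi).2 (Finset.mem_singleton_self i)
    rw [hij] at label_i
    exact (Finset.mem_singleton.1 ((hf j hj).1 label_i)).symm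
  have shatters_image : Shatters F (S.image z) := by
    intro T _
    obtain ⟨f, hf, hfT⟩ := exists_of_subset (Finset.filter_subset (fun i => z i ∈ T) S)
    refine ⟨f, hf, Finset.forall_mem_image.2 fun i hi => ?_⟩
    rw [hfT i hi, Finset.mem_filter, and_iff_right hi]
  rw [← Finset.card_image_of_injOn injOn, ← ENat.natCast_le_natCast]
  exact (le_iSup₂ (f := fun (S : Finset 𝒳) (_ : Shatters F S) => (S.card : ℕ∞)) _
    shatters_image).trans hF

lemma sgn_eq_ite (t : ℝ) : sgn t = if sgn t = 1 then 1 else -1 := by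
  unfold sgn
  split_ifs <;> simp_all

/-- The sign of `f` determines its error set, so each trace of an error set is a function of the
trace of a positive set. -/
lemma mem_trace_errorSets_iff [DecidableEq ι] {F : Set (𝒳 → ℝ)} {y : 𝒳 → ℝ} {z : ι → 𝒳}
    {T : Finset ι} :
    T ∈ trace (errorSets F y) z ↔
      ∃ U ∈ trace (positiveSets F) z, ∀ i, i ∈ T ↔ (if i ∈ U then 1 else -1) ≠ y (z i) := by
  simp only [mem_trace, errorSets, positiveSets, Set.exists_mem_image, Set.mem_ofPred_eq]
  constructor
  · rintro ⟨f, hf, hT⟩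
    refine ⟨Finset.univ.filter fun i => sgn (f (z i)) = 1, ⟨f, hf, by simp⟩, fun i => ?_⟩
    rw [hT, sgn_eq_ite]
    simp
  · rintro ⟨U, ⟨f, hf, hU⟩, hT⟩
    refine ⟨f, hf, fun i => ?_⟩
    rw [hT, sgn_eq_ite]
    simp only [hU]

lemma card_trace_errorSets_le (F : Set (𝒳 → ℝ)) (y : 𝒳 → ℝ) (z : ι → 𝒳) :
    (trace (errorSets F y) z).card ≤ (trace (positiveSets F) z).card := by
  classical
  refine Finset.card_le_card_of_surjOn
    (fun U => Finset.univ.filter fun i => (if i ∈ U then 1 else -1) ≠ y (z i)) fun T hT => ?_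
  obtain ⟨U, hU, hTU⟩ := mem_trace_errorSets_iff.1 hT
  exact ⟨U, hU, Finset.ext fun i => by simp only [hTU, Finset.mem_filter, Finset.mem_univ,
    true_and]⟩

lemma card_trace_errorSets_le_exp {F : Set (𝒳 → ℝ)} {h : ℕ} (hF : vcDim F ≤ h)
    (hι : h ≤ Fintype.card ι) (y : 𝒳 → ℝ) (z : ι → 𝒳) :
    ((trace (errorSets F y) z).card : ℝ) ≤
      Real.exp (h * (Real.log (Fintype.card ι / h) + 1)) := by
  classical
  refine le_trans ?_ (sum_choose_le_exp hι)
  exact_mod_cast (card_trace_errorSets_le F y z).trans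
    (card_le_sum_choose_of_vcDim_le (vcDim_trace_positiveSets_le hF z))

end Growth

section TraceMoment

variable {𝒳 : Type*}

/-- The sum, over the traces of `𝒜` on the pooled sample and ghost sample `z`, of the exponential
moments of the gap between the two halves. As a function of `z` it dominates `exp (t * gap)` for
all members of `𝒜` at once, and it is measurable as soon as the events `T ∈ trace 𝒜 z` are. -/
noncomputable def traceMoment (𝒜 : Set (Set 𝒳)) (t : ℝ) {n : ℕ} (z : Fin (n + n) → 𝒳) : ℝ :=
  ∑ T ∈ trace 𝒜 z, Real.exp (t * halvesGap ((T : Set (Fin (n + n))).indicator 1))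

lemma traceMoment_nonneg (𝒜 : Set (Set 𝒳)) (t : ℝ) {n : ℕ} (z : Fin (n + n) → 𝒳) :
    0 ≤ traceMoment 𝒜 t z :=
  Finset.sum_nonneg fun _ _ => (Real.exp_pos _).le

lemma traceMoment_comp_perm (𝒜 : Set (Set 𝒳)) (t : ℝ) {n : ℕ} (z : Fin (n + n) → 𝒳)
    (π : Equiv.Perm (Fin (n + n))) :
    traceMoment 𝒜 t (z ∘ π) =
      ∑ T ∈ trace 𝒜 z, Real.exp (t * halvesGap ((T : Set (Fin (n + n))).indicator 1 ∘ π)) := by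
  rw [traceMoment, trace_comp_equiv, Finset.sum_map]
  refine Finset.sum_congr rfl fun T _ => ?_
  congr 3
  ext i
  simp only [Function.comp_apply, Set.indicator_apply, Finset.mem_coe, Pi.one_apply]
  exact if_congr Finset.mem_map_equiv rfl rfl

lemma expect_perm_traceMoment_le (𝒜 : Set (Set 𝒳)) (t : ℝ) {n : ℕ} (hn : 0 < n)
    (z : Fin (n + n) → 𝒳) :
    𝔼 π : Equiv.Perm (Fin (n + n)), traceMoment 𝒜 t (z ∘ π) ≤
      (trace 𝒜 z).card * Real.exp (t ^ 2 * (n + 1) / 4) := by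
  simp only [traceMoment_comp_perm]
  rw [Finset.expect_sum_comm, ← nsmul_eq_mul]
  exact Finset.sum_le_card_nsmul _ _ _ fun T _ => expect_perm_exp_mul_halvesGap_le hn
    (fun i => ⟨Set.indicator_nonneg (fun _ _ => zero_le_one) i,
      Set.indicator_le_self' (fun _ _ => zero_le_one) i⟩) t

lemma exp_mul_halvesGap_le_traceMoment {𝒜 : Set (Set 𝒳)} {A : Set 𝒳} (hA : A ∈ 𝒜) (t : ℝ)
    {n : ℕ} (z : Fin (n + n) → 𝒳) :
    Real.exp (t * halvesGap (A.indicator 1 ∘ z)) ≤ traceMoment 𝒜 t z := by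
  classical
  set T : Finset (Fin (n + n)) := Finset.univ.filter fun i => z i ∈ A
  have hT : T ∈ trace 𝒜 z := mem_trace.2 ⟨A, hA, fun i => by simp [T]⟩
  have indicator_eq : A.indicator (1 : 𝒳 → ℝ) ∘ z = (T : Set (Fin (n + n))).indicator 1 := by
    ext i
    simp [T, Set.indicator_apply]
  rw [indicator_eq]
  exact Finset.single_le_sum (f := fun T : Finset (Fin (n + n)) =>
    Real.exp (t * halvesGap ((T : Set (Fin (n + n))).indicator 1)))
    (fun _ _ => (Real.exp_pos _).le) hT

end TraceMoment

section Symmetrization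

variable {𝒳 : Type*} [MeasurableSpace 𝒳] (P : Measure 𝒳)

lemma measurePreserving_comp_equiv [SigmaFinite P] {ι κ : Type*} [Fintype ι] [Fintype κ]
    (e : κ ≃ ι) :
    MeasurePreserving (fun z : ι → 𝒳 => z ∘ e) (Measure.pi fun _ => P) (Measure.pi fun _ => P) := by
  convert measurePreserving_piCongrLeft (fun _ : κ => P) e.symm using 1
  ext z k
  rw [← e.symm_apply_apply k, MeasurableEquiv.coe_piCongrLeft, Equiv.piCongrLeft_apply_apply]
  simp

lemma measurePreserving_finAppend [SigmaFinite P] (m n : ℕ) :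
    MeasurePreserving (fun p : (Fin m → 𝒳) × (Fin n → 𝒳) => Fin.append p.1 p.2)
      ((Measure.pi fun _ => P).prod (Measure.pi fun _ => P)) (Measure.pi fun _ => P) := by
  convert (measurePreserving_comp_equiv P finSumFinEquiv.symm).comp
    (measurePreserving_sumPiEquivProdPi_symm fun _ : Fin m ⊕ Fin n => P) using 1
  ext p i
  refine Fin.addCases (fun i => ?_) (fun i => ?_) i <;>
    simp [MeasurableEquiv.coe_sumPiEquivProdPi_symm]

lemma lintegral_ofReal_pi_le_of_expect_perm_le [IsProbabilityMeasure P] {ι : Type*} [Fintype ι]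
    [DecidableEq ι] {G : (ι → 𝒳) → ℝ} (hG : AEMeasurable G (Measure.pi fun _ => P))
    (hG_nonneg : ∀ z, 0 ≤ G z) {c : ℝ} (hc : ∀ z, 𝔼 π : Equiv.Perm ι, G (z ∘ π) ≤ c) :
    ∫⁻ z, ENNReal.ofReal (G z) ∂(Measure.pi fun _ => P) ≤ ENNReal.ofReal c := by
  set ν := Measure.pi fun _ : ι => P
  have lintegral_comp_perm (π : Equiv.Perm ι) :
      ∫⁻ z, ENNReal.ofReal (G (z ∘ π)) ∂ν = ∫⁻ z, ENNReal.ofReal (G z) ∂ν := by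
    have preserving := measurePreserving_comp_equiv P π
    rw [← lintegral_map' (f := fun z => ENNReal.ofReal (G z))
      (by rw [preserving.map_eq]; exact hG.ennreal_ofReal) preserving.aemeasurable,
      preserving.map_eq]
  have sum_perm_le (z : ι → 𝒳) :
      ∑ π : Equiv.Perm ι, ENNReal.ofReal (G (z ∘ π)) ≤
        Fintype.card (Equiv.Perm ι) * ENNReal.ofReal c := by
    rw [← ENNReal.ofReal_sum_of_nonneg fun _ _ => hG_nonneg _, ← Fintype.card_mul_expect,
      ENNReal.ofReal_mul (Nat.cast_nonneg _), ENNReal.ofReal_natCast]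
    gcongr
    exact hc z
  refine (ENNReal.mul_le_mul_iff_right (a := (Fintype.card (Equiv.Perm ι) : ENNReal))
    (by simp [Fintype.card_ne_zero]) (ENNReal.natCast_ne_top _)).1 ?_
  calc _ = ∑ π : Equiv.Perm ι, ∫⁻ z, ENNReal.ofReal (G (z ∘ π)) ∂ν := by
        simp only [lintegral_comp_perm, Finset.sum_const, Finset.card_univ, nsmul_eq_mul]
    _ = ∫⁻ z, ∑ π : Equiv.Perm ι, ENNReal.ofReal (G (z ∘ π)) ∂ν :=
        (lintegral_finsetSum' _ fun π _ => (hG.comp_quasiMeasurePreserving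
          (measurePreserving_comp_equiv P π).quasiMeasurePreserving).ennreal_ofReal).symm
    _ ≤ ∫⁻ _, Fintype.card (Equiv.Perm ι) * ENNReal.ofReal c ∂ν := lintegral_mono sum_perm_le
    _ = _ := by rw [lintegral_const, measure_univ, mul_one]

lemma ofReal_exp_integral_le_lintegral {α : Type*} [MeasurableSpace α] {ν : Measure α}
    [IsProbabilityMeasure ν] {g : α → ℝ} (hg : Integrable g ν) :
    ENNReal.ofReal (Real.exp (∫ a, g a ∂ν)) ≤ ∫⁻ a, ENNReal.ofReal (Real.exp (g a)) ∂ν := by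
  have exp_nonneg : 0 ≤ᵐ[ν] fun a => Real.exp (g a) := ae_of_all _ fun a => (Real.exp_pos _).le
  by_cases h_exp : Integrable (fun a => Real.exp (g a)) ν
  · rw [← ofReal_integral_eq_lintegral_ofReal h_exp exp_nonneg]
    exact ENNReal.ofReal_le_ofReal <| convexOn_exp.map_integral_le Real.continuous_exp.continuousOn
      isClosed_univ (ae_of_all _ fun _ => Set.mem_univ _) hg h_exp
  · rw [← lintegral_ofReal_ne_top_iff_integrable
      (Real.continuous_exp.comp_aestronglyMeasurable hg.aestronglyMeasurable) exp_nonneg,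
      not_ne_iff] at h_exp
    exact h_exp ▸ le_top

lemma aemeasurable_traceMoment {𝒜 : Set (Set 𝒳)} {n : ℕ}
    (h𝒜 : ∀ T, NullMeasurableSet {z : Fin (n + n) → 𝒳 | T ∈ trace 𝒜 z} (Measure.pi fun _ => P))
    (t : ℝ) : AEMeasurable (traceMoment 𝒜 t : (Fin (n + n) → 𝒳) → ℝ) (Measure.pi fun _ => P) := by
  classical
  have traceMoment_eq : (traceMoment 𝒜 t : (Fin (n + n) → 𝒳) → ℝ) = fun z =>
      ∑ T, {z : Fin (n + n) → 𝒳 | T ∈ trace 𝒜 z}.indicator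
        (fun _ => Real.exp (t * halvesGap ((T : Set (Fin (n + n))).indicator 1))) z := by
    ext z
    simp only [traceMoment, Set.indicator_apply, Set.mem_ofPred_eq, Finset.sum_ite_mem,
      Finset.univ_inter]
  rw [traceMoment_eq]
  exact Finset.aemeasurable_fun_sum _ fun T _ => aemeasurable_const.indicator₀ (h𝒜 T)

lemma lintegral_traceMoment_le [IsProbabilityMeasure P] {𝒜 : Set (Set 𝒳)} {n : ℕ} (hn : 0 < n)
    (h𝒜 : ∀ T, NullMeasurableSet {z : Fin (n + n) → 𝒳 | T ∈ trace 𝒜 z} (Measure.pi fun _ => P))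
    {N : ℝ} (hN : ∀ z : Fin (n + n) → 𝒳, (trace 𝒜 z).card ≤ N) (t : ℝ) :
    ∫⁻ z, ENNReal.ofReal (traceMoment 𝒜 t z) ∂(Measure.pi fun _ : Fin (n + n) => P) ≤
      ENNReal.ofReal (N * Real.exp (t ^ 2 * (n + 1) / 4)) := by
  refine lintegral_ofReal_pi_le_of_expect_perm_le P (aemeasurable_traceMoment P h𝒜 t)
    (traceMoment_nonneg 𝒜 t) fun z => (expect_perm_traceMoment_le 𝒜 t hn z).trans ?_
  gcongr
  exact hN z

/-- The ghost sample enters through Jensen's inequality: the mean of its part of the gap is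
`n * P.real A`. -/
lemma ofReal_exp_mul_sub_le_lintegral_traceMoment [IsProbabilityMeasure P] {𝒜 : Set (Set 𝒳)}
    {A : Set 𝒳} (hA : A ∈ 𝒜) (hA_meas : MeasurableSet A) (t : ℝ) {n : ℕ} (x : Fin n → 𝒳) :
    ENNReal.ofReal (Real.exp (t * (n * P.real A - ∑ i, A.indicator 1 (x i)))) ≤
      ∫⁻ x', ENNReal.ofReal (traceMoment 𝒜 t (Fin.append x x')) ∂(Measure.pi fun _ => P) := by
  set g : (Fin n → 𝒳) → ℝ := fun x' => t * halvesGap (A.indicator 1 ∘ Fin.append x x') with hg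
  have g_eq : g = fun x' => t * (∑ i, A.indicator 1 (x' i) - ∑ i, A.indicator 1 (x i)) := by
    simp only [hg, halvesGap, Function.comp_apply, Fin.append_left, Fin.append_right]
  have integrable_indicator : Integrable (A.indicator (1 : 𝒳 → ℝ)) P :=
    (integrable_const 1).indicator hA_meas
  have integrable_eval (i : Fin n) :
      Integrable (fun x' : Fin n → 𝒳 => A.indicator (1 : 𝒳 → ℝ) (x' i)) (Measure.pi fun _ => P) :=
    integrable_comp_eval (μ := fun _ => P) integrable_indicator
  have integrable_sum := integrable_finsetSum Finset.univ fun i _ => integrable_eval i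
  have integral_g : ∫ x', g x' ∂(Measure.pi fun _ => P) =
      t * (n * P.real A - ∑ i, A.indicator 1 (x i)) := by
    rw [g_eq, integral_const_mul, integral_sub integrable_sum (integrable_const _),
      integral_finsetSum _ fun i _ => integrable_eval i]
    simp only [integral_comp_eval (μ := fun _ : Fin n => P)
      integrable_indicator.aestronglyMeasurable, integral_indicator_one hA_meas, integral_const,
      Finset.sum_const, Finset.card_univ, Fintype.card_fin, nsmul_eq_mul, probReal_univ, one_smul]
  have integrable_g : Integrable g (Measure.pi fun _ => P) := by
    rw [g_eq]
    exact (integrable_sum.sub (integrable_const _)).const_mul t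
  rw [← integral_g]
  refine (ofReal_exp_integral_le_lintegral integrable_g).trans (lintegral_mono fun x' => ?_)
  exact ENNReal.ofReal_le_ofReal (exp_mul_halvesGap_le_traceMoment hA t _)

lemma lintegral_lintegral_finAppend [SigmaFinite P] {m n : ℕ} {G : (Fin (m + n) → 𝒳) → ENNReal}
    (hG : AEMeasurable G (Measure.pi fun _ => P)) :
    ∫⁻ x, ∫⁻ x', G (Fin.append x x') ∂(Measure.pi fun _ => P) ∂(Measure.pi fun _ => P) =
      ∫⁻ z, G z ∂(Measure.pi fun _ => P) := by
  have preserving := measurePreserving_finAppend P m n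
  rw [← preserving.map_eq] at hG ⊢
  rw [lintegral_map' hG preserving.aemeasurable]
  exact (lintegral_prod _ (hG.comp_aemeasurable preserving.aemeasurable)).symm

/-- Vapnik and Chervonenkis' uniform deviation inequality. The choice `t = 2 * ε` minimises the
leading part `t ^ 2 * n / 4 - t * (n * ε)` of the exponent in the exponential Markov inequality. -/
theorem measure_exists_add_le_measureReal_le [IsProbabilityMeasure P] {𝒜 : Set (Set 𝒳)}
    (h𝒜_meas : ∀ A ∈ 𝒜, MeasurableSet A) {n : ℕ} (hn : 0 < n)
    (h𝒜 : ∀ T, NullMeasurableSet {z : Fin (n + n) → 𝒳 | T ∈ trace 𝒜 z} (Measure.pi fun _ => P))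
    {N : ℝ} (hN : ∀ z : Fin (n + n) → 𝒳, (trace 𝒜 z).card ≤ N) {ε : ℝ} (hε : 0 ≤ ε) :
    Measure.pi (fun _ => P)
        {x : Fin n → 𝒳 | ∃ A ∈ 𝒜, (∑ i, A.indicator 1 (x i)) / n + ε ≤ P.real A} ≤
      ENNReal.ofReal (N * Real.exp (-((n - 1) * ε ^ 2))) := by
  set t := 2 * ε with ht
  have aemeasurable_moment := (aemeasurable_traceMoment P h𝒜 t).ennreal_ofReal
  set M : (Fin n → 𝒳) → ENNReal := fun x =>
    ∫⁻ x', ENNReal.ofReal (traceMoment 𝒜 t (Fin.append x x')) ∂(Measure.pi fun _ => P) with hM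
  have aemeasurable_M : AEMeasurable M (Measure.pi fun _ => P) :=
    (aemeasurable_moment.comp_quasiMeasurePreserving
      (measurePreserving_finAppend P n n).quasiMeasurePreserving).lintegral_prod_right'
  have le_M {x : Fin n → 𝒳}
      (hx : ∃ A ∈ 𝒜, (∑ i, A.indicator 1 (x i)) / n + ε ≤ P.real A) :
      ENNReal.ofReal (Real.exp (t * (n * ε))) ≤ M x := by
    obtain ⟨A, hA, hxA⟩ := hx
    refine le_trans ?_ (ofReal_exp_mul_sub_le_lintegral_traceMoment P hA (h𝒜_meas A hA) t x)
    gcongr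
    have scaled := mul_le_mul_of_nonneg_left hxA (Nat.cast_nonneg n)
    rw [mul_add, mul_div_cancel₀ _ (by positivity)] at scaled
    linarith
  calc _ ≤ Measure.pi (fun _ => P) {x | ENNReal.ofReal (Real.exp (t * (n * ε))) ≤ M x} :=
        measure_mono fun x hx => le_M hx
    _ ≤ (∫⁻ x, M x ∂(Measure.pi fun _ => P)) / ENNReal.ofReal (Real.exp (t * (n * ε))) :=
        meas_ge_le_lintegral_div aemeasurable_M (by positivity) ENNReal.ofReal_ne_top
    _ ≤ ENNReal.ofReal (N * Real.exp (t ^ 2 * (n + 1) / 4)) /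
          ENNReal.ofReal (Real.exp (t * (n * ε))) := by
        gcongr
        rw [hM, lintegral_lintegral_finAppend P aemeasurable_moment]
        exact lintegral_traceMoment_le P hn h𝒜 hN t
    _ = _ := by
        rw [← ENNReal.ofReal_div_of_pos (Real.exp_pos _), mul_div_assoc, ← Real.exp_sub, ht]
        congr 3
        ring

end Symmetrization

section Risk

lemma zeroOneLoss_nonneg (a b : ℝ) : 0 ≤ zeroOneLoss a b := by
  unfold zeroOneLoss
  split_ifs <;> simp

lemma zeroOneLoss_le_sq_sub (l : ℝ) {b : ℝ} (hb : b = -1 ∨ b = 1) :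
    zeroOneLoss l b ≤ (l - b) ^ 2 := by
  unfold zeroOneLoss sgn
  rcases hb with rfl | rfl <;> split_ifs <;> first | positivity | nlinarith | simp_all

lemma zeroOneLoss_triangle (a l b : ℝ) :
    zeroOneLoss a b ≤ zeroOneLoss a (sgn l) + zeroOneLoss l b := by
  unfold zeroOneLoss
  split_ifs <;> simp_all

lemma zeroOneLoss_le_add_sq_sub (a l : ℝ) {b : ℝ} (hb : b = -1 ∨ b = 1) :
    zeroOneLoss a b ≤ zeroOneLoss a (sgn l) + (l - b) ^ 2 :=
  (zeroOneLoss_triangle a l b).trans (by gcongr; exact zeroOneLoss_le_sq_sub l hb)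

lemma measurable_sgn : Measurable sgn :=
  Measurable.ite measurableSet_Ici measurable_const measurable_const

variable {𝒳 : Type*} {F : Set (𝒳 → ℝ)} {y : 𝒳 → ℝ}

lemma zeroOneLoss_eq_indicator (f : 𝒳 → ℝ) (x : 𝒳) :
    zeroOneLoss (f x) (y x) = {x | sgn (f x) ≠ y x}.indicator 1 x := by
  classical
  rw [Set.indicator_apply]
  rfl

variable [MeasurableSpace 𝒳] {P : Measure 𝒳}

lemma measurableSet_sgn_ne {f : 𝒳 → ℝ} (hf : Measurable f) (hy : Measurable y) :
    MeasurableSet {x | sgn (f x) ≠ y x} :=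
  (measurableSet_eq_fun (measurable_sgn.comp hf) hy).compl

lemma risk_eq_measureReal {f : 𝒳 → ℝ} (hf : Measurable f) (hy : Measurable y) :
    risk P y f = P.real {x | sgn (f x) ≠ y x} := by
  simp only [risk, zeroOneLoss_eq_indicator]
  exact integral_indicator_one (measurableSet_sgn_ne hf hy)

lemma risk_le_one [IsProbabilityMeasure P] {f : 𝒳 → ℝ} (hf : Measurable f) (hy : Measurable y) :
    risk P y f ≤ 1 :=
  (risk_eq_measureReal hf hy).trans_le measureReal_le_one

lemma IsMeasurableClass.nullMeasurableSet_mem_trace_positiveSets (hF : IsMeasurableClass P F)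
    {m : ℕ} (U : Finset (Fin m)) :
    NullMeasurableSet {z : Fin m → 𝒳 | U ∈ trace (positiveSets F) z} (Measure.pi fun _ => P) := by
  convert hF.nullMeasurableSet m fun i => if i ∈ U then 1 else -1 using 2
  ext z
  simp only [mem_trace, positiveSets, Set.exists_mem_image, Set.mem_ofPred_eq]
  refine exists_congr fun f => and_congr_right fun _ => forall_congr' fun i => ?_
  rw [sgn_eq_ite (f (z i))]
  split_ifs <;> norm_num [*]

lemma IsMeasurableClass.nullMeasurableSet_mem_trace_errorSets (hF : IsMeasurableClass P F)
    (hy : Measurable y) {m : ℕ} (T : Finset (Fin m)) :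
    NullMeasurableSet {z : Fin m → 𝒳 | T ∈ trace (errorSets F y) z} (Measure.pi fun _ => P) := by
  have eq_iUnion : {z : Fin m → 𝒳 | T ∈ trace (errorSets F y) z} =
      ⋃ U, {z | U ∈ trace (positiveSets F) z} ∩
        {z | ∀ i, i ∈ T ↔ (if i ∈ U then 1 else -1) ≠ y (z i)} := by
    ext z
    simp only [Set.mem_ofPred_eq, Set.mem_iUnion, Set.mem_inter_iff, mem_trace_errorSets_iff]
  rw [eq_iUnion]
  refine .iUnion fun U => (hF.nullMeasurableSet_mem_trace_positiveSets U).inter ?_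
  refine MeasurableSet.nullMeasurableSet <| measurableSet_setOfPred.2 <| .forall fun i => ?_
  exact measurable_const.iff <| Measurable.not <| measurableSet_setOfPred.1 <|
    measurableSet_eq_fun measurable_const (hy.comp (measurable_pi_apply i))

lemma mul_inductiveError_sq {h n : ℕ} (hn : 0 < n) (hhn : h ≤ 2 * n) {η : ℝ} (hη_pos : 0 < η)
    (hη_le : η ≤ 1) :
    n * inductiveError h n η ^ 2 = h * (Real.log (2 * n / h) + 1) - Real.log (η / 4) := by
  have complexity_nonneg : 0 ≤ h * (Real.log (2 * n / h) + 1) := by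
    rcases Nat.eq_zero_or_pos h with rfl | h_pos
    · simp
    · have one_le_ratio : 1 ≤ (2 * n / h : ℝ) :=
        (one_le_div (by positivity)).2 (by exact_mod_cast hhn)
      have := Real.log_nonneg one_le_ratio
      positivity
  have log_nonpos : Real.log (η / 4) ≤ 0 := Real.log_nonpos (by positivity) (by linarith)
  rw [inductiveError, Real.sq_sqrt (div_nonneg (by linarith) (by positivity)),
    mul_div_cancel₀ _ (by positivity)]

lemma exp_mul_exp_neg_inductiveError_sq_le {h n : ℕ} (hn : 0 < n) (hhn : h ≤ 2 * n) {η : ℝ}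
    (hη_pos : 0 < η) (hη_le : η ≤ 1) (hε : inductiveError h n η ≤ 1) :
    Real.exp (h * (Real.log (2 * n / h) + 1)) *
      Real.exp (-((n - 1) * inductiveError h n η ^ 2)) ≤ η := by
  have sq_le_one : inductiveError h n η ^ 2 ≤ 1 := pow_le_one₀ (Real.sqrt_nonneg _) hε
  have one_le_log_four : 1 ≤ Real.log 4 := by
    rw [Real.le_log_iff_exp_le (by norm_num)]
    linarith [Real.exp_one_lt_three]
  have mul_sq := mul_inductiveError_sq hn hhn hη_pos hη_le
  rw [Real.log_div hη_pos.ne' (by norm_num)] at mul_sq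
  rw [← Real.exp_add, ← Real.le_log_iff_exp_le hη_pos]
  linarith

theorem measure_exists_empiricalRisk_add_lt_risk_le [IsProbabilityMeasure P] (hy : Measurable y)
    (hF : IsMeasurableClass P F) {h : ℕ} (hvc : vcDim F ≤ h) {n : ℕ} (hn : 0 < n)
    (hhn : h ≤ 2 * n) {η : ℝ} (hη_pos : 0 < η) (hη_le : η ≤ 1) :
    Measure.pi (fun _ => P) {x : Fin n → 𝒳 | ∃ f ∈ F,
      (1 / (n : ℝ)) * ∑ i, zeroOneLoss (f (x i)) (y (x i)) + inductiveError h n η < risk P y f} ≤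
        ENNReal.ofReal η := by
  set ε := inductiveError h n η
  have ε_nonneg : 0 ≤ ε := Real.sqrt_nonneg _
  rcases le_or_gt 1 ε with one_le_ε | ε_lt_one
  · refine (measure_mono (t := ∅) ?_).trans (by rw [measure_empty]; exact zero_le)
    rintro x ⟨f, hf, hlt⟩
    have empirical_nonneg : 0 ≤ (1 / (n : ℝ)) * ∑ i, zeroOneLoss (f (x i)) (y (x i)) :=
      mul_nonneg (by positivity) (Finset.sum_nonneg fun i _ => zeroOneLoss_nonneg _ _)
    have risk_le := risk_le_one (P := P) (hF.measurable f hf) hy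
    exact absurd hlt (not_lt.2 (by linarith))
  have card_le (z : Fin (n + n) → 𝒳) :
      ((trace (errorSets F y) z).card : ℝ) ≤ Real.exp (h * (Real.log (2 * n / h) + 1)) := by
    refine (card_trace_errorSets_le_exp hvc (by rw [Fintype.card_fin]; omega) y z).trans_eq ?_
    rw [Fintype.card_fin, Nat.cast_add, ← two_mul]
  have measurableSet_errorSets : ∀ A ∈ errorSets F y, MeasurableSet A :=
    Set.forall_mem_image.2 fun f hf => measurableSet_sgn_ne (hF.measurable f hf) hy
  refine le_trans (measure_mono ?_) <| (measure_exists_add_le_measureReal_le P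
    measurableSet_errorSets hn (hF.nullMeasurableSet_mem_trace_errorSets hy) card_le
    ε_nonneg).trans <| ENNReal.ofReal_le_ofReal <|
    exp_mul_exp_neg_inductiveError_sq_le hn hhn hη_pos hη_le ε_lt_one.le
  rintro x ⟨f, hf, hlt⟩
  refine ⟨_, Set.mem_image_of_mem _ hf, ?_⟩
  rw [risk_eq_measureReal (hF.measurable f hf) hy, one_div_mul_eq_div] at hlt
  simpa only [zeroOneLoss_eq_indicator] using hlt.le

end Risk

end MaxMarginCuts

theorem mainTheorem4 {Ω 𝒳 : Type*} [MeasurableSpace Ω] [MeasurableSpace 𝒳]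
    (μ : Measure Ω) [IsProbabilityMeasure μ] (P : Measure 𝒳) [IsProbabilityMeasure P]
    (y : 𝒳 → ℝ) (hy : Measurable y) (hy_label : ∀ x, y x = -1 ∨ y x = 1)
    (F : Set (𝒳 → ℝ)) (hF : MaxMarginCuts.IsMeasurableClass P F)
    (h : ℕ) (hvc : MaxMarginCuts.vcDim F = (h : ℕ∞))
    (n : ℕ) (hn : 1 ≤ n) (hhn : h ≤ 2 * n)
    (η : ℝ) (hη_pos : 0 < η) (hη_le : η ≤ 1)
    (x : Fin n → Ω → 𝒳) (hx : ∀ i, Measurable (x i)) (hx_indep : iIndepFun x μ)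
    (hx_law : ∀ i, μ.map (x i) = P) :
    ∃ A : Set Ω, MeasurableSet A ∧ 1 - η ≤ μ.real A ∧
      ∀ ω ∈ A, ∀ f ∈ F, ∀ l : Fin n → ℝ,
        MaxMarginCuts.risk P y f ≤
          (1 / (n : ℝ)) * ∑ i, MaxMarginCuts.zeroOneLoss (f (x i ω)) (MaxMarginCuts.sgn (l i)) +
          (1 / (n : ℝ)) * ∑ i, (l i - y (x i ω)) ^ 2 +
          MaxMarginCuts.inductiveError h n η := by
  set X : Ω → Fin n → 𝒳 := fun ω i => x i ω
  have hX : Measurable X := measurable_pi_lambda X hx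
  have map_X : μ.map X = Measure.pi fun _ => P := by
    rw [(iIndepFun_iff_map_fun_eq_pi_map fun i => (hx i).aemeasurable).1 hx_indep]
    simp only [hx_law]
  set bad : Set (Fin n → 𝒳) := {z | ∃ f ∈ F, (1 / (n : ℝ)) *
    ∑ i, MaxMarginCuts.zeroOneLoss (f (z i)) (y (z i)) + MaxMarginCuts.inductiveError h n η <
      MaxMarginCuts.risk P y f}
  have measure_bad_le : μ (toMeasurable μ (X ⁻¹' bad)) ≤ ENNReal.ofReal η := by
    rw [measure_toMeasurable]
    exact (Measure.le_map_apply hX.aemeasurable bad).trans <| map_X ▸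
      MaxMarginCuts.measure_exists_empiricalRisk_add_lt_risk_le hy hF hvc.le hn hhn hη_pos hη_le
  refine ⟨(toMeasurable μ (X ⁻¹' bad))ᶜ, (measurableSet_toMeasurable _ _).compl, ?_, ?_⟩
  · rw [probReal_compl_eq_one_sub (measurableSet_toMeasurable _ _)]
    exact sub_le_sub_left (ENNReal.toReal_le_of_le_ofReal hη_pos.le measure_bad_le) 1
  · intro ω hω f hf l
    have risk_le := not_lt.1 fun hlt => hω (subset_toMeasurable μ (X ⁻¹' bad) ⟨f, hf, hlt⟩)
    refine risk_le.trans ?_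
    rw [← mul_add, ← Finset.sum_add_distrib]
    gcongr with i
    exact MaxMarginCuts.zeroOneLoss_le_add_sq_sub _ _ (hy_label _)
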